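/- Let $\Gamma$ be a finite bipartite graph (multiple edges are allowed) with colour classes $B$ and $W$, $|B|=|W|=n$, and edge set $E$, together with an embedding in the plane, that is, a rotation system (a cyclic order of the edges at each vertex) for which every connected component containing an edge satisfies Euler's formula $V-E+F=2$; here the faces are the closed facial walks (boundary walks) determined by the rotation system. The length of a face is the length of its facial walk, so an edge that the walk passes twice counts twice. Let $\kappa:E\to\{+1,-1\}$ be a Kasteleyn weighting: the number of edges $\varepsilon$ with $\kappa(\varepsilon)=-1$ around each face, counted with the same multiplicity, is odd if the length of the face is $0$ mod $4$, and even if it is $2$ mod $4$. (If $\Gamma$ is connected these are the faces of the plane graph in the usual sense; if $\Gamma$ is disconnected the condition is imposed on each facial walk separately.) Number the vertices as $B=\{b_1,\dots,b_n\}$ and $W=\{w_1,\dots,w_n\}$ in any way, let $(x_\varepsilon)_{\varepsilon\in E}$ be independent formal variables, and let $M=(m_{ij})$ be the signed bipartite adjacency submatrix $$m_{ij}=\sum_{\varepsilon\text{ joins }b_i\text{ and }w_j}\kappa(\varepsilon)\,x_\varepsilon\in\mathbb Z[x_\varepsilon:\varepsilon\in E].$$ For a permutation $\sigma\in S_n$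 let $t_\sigma=\operatorname{sgn}(\sigma)\prod_{i=1}^n m_{i\sigma(i)}$ be its term in the expansion $\det M=\sum_{\sigma\in S_n} t_\sigma$, and say that a perfect matching $\mu\subseteq E$ induces $\sigma$ if every edge of $\mu$ joins $b_i$ to $w_{\sigma(i)}$ for some $i$. Then 1. $t_\sigma\neq0$ if and only if some perfect matching of $\Gamma$ induces $\sigma$, and every perfect matching induces exactly one permutation; 2. there is one overall sign $\epsilon\in\{+1,-1\}$ such that for every $\sigma\in S_n$ $$t_\sigma=\epsilon\sum_{\mu\text{ inducing }\sigma}\ \prod_{\varepsilon\in\mu}x_\varepsilon,\qquad\text{hence}\qquad \det M=\epsilon\sum_{\mu}\ \prod_{\varepsilon\in\mu}x_\varepsilon,$$ the last sum being over all perfect matchings $\mu$ of $\Gamma$. If $\Gamma$ has no multiple edges, then for every $\sigma$ with $t_\sigma\ne0$ there is exactly one perfect matching $\mu$ inducing $\sigma$, and $t_\sigma=\epsilon\prod_{\varepsilon\in\mu}x_\varepsilon$; so the non-zero terms correspond one-to-one to the perfect matchings. -/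

import Mathlib

open scoped BigOperators

/-- A bipartite graph with colour classes `B` (the first vertex set) and `W` (the second vertex
set) and edge set `E`. Each edge joins its end in `B` to its end in `W`; several edges may have the
same two ends. -/
structure BipartiteGraph (B W E : Type*) where
  black : E → B
  white : E → W

namespace BipartiteGraph

variable {B W E : Type*}

/-- No two different edges have the same two ends. -/
def IsSimple (G : BipartiteGraph B W E) : Prop :=
  ∀ e e' : E, G.black e = G.black e' → G.white e = G.white e' → e = e'

/-- The underlying simple graph on the set of all vertices; it is used only to speak of connected
components. -/
def toSimpleGraph (G : BipartiteGraph B W E) : SimpleGraph (B ⊕ W) :=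
  SimpleGraph.fromRel fun u v => ∃ e : E, u = Sum.inl (G.black e) ∧ v = Sum.inr (G.white e)

/-- The darts (edges with a direction) are the pairs in `E × Bool`: `(e, false)` is the edge `e`
directed away from its end in `B`, and `(e, true)` is `e` directed away from its end in `W`.
This is the vertex from which a dart starts. -/
def origin (G : BipartiteGraph B W E) : E × Bool → B ⊕ W
  | (e, false) => Sum.inl (G.black e)
  | (e, true) => Sum.inr (G.white e)

/-- The reversal of darts. -/
def reversal (E : Type*) : Equiv.Perm (E × Bool) :=
  Equiv.prodCongr (Equiv.refl E) Equiv.boolNot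

/-- A rotation system: a permutation of the darts whose cycles are exactly the sets of darts that
start from a common vertex. It gives, at every vertex, the (say counterclockwise) cyclic order of
the edges at that vertex in a drawing on an oriented surface. -/
structure RotationSystem (G : BipartiteGraph B W E) where
  next : Equiv.Perm (E × Bool)
  sameCycle_iff : ∀ d d' : E × Bool, next.SameCycle d d' ↔ G.origin d = G.origin d'

namespace RotationSystem

variable {G : BipartiteGraph B W E}

/-- The facial walk: traverse a dart to its end, then leave that vertex along the edge which comes
next in the rotation. -/
def facePerm (R : G.RotationSystem) : Equiv.Perm (E × Bool) :=
  R.next * reversal E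

/-- The faces, as cyclic facial walks, that is, as orbits of `facePerm`. -/
def Face (R : G.RotationSystem) : Type _ :=
  Quotient (Equiv.Perm.SameCycle.setoid R.facePerm)

/-- The face that a dart runs along. -/
def faceOf (R : G.RotationSystem) (d : E × Bool) : R.Face :=
  Quotient.mk (Equiv.Perm.SameCycle.setoid R.facePerm) d

/-- The length of a face: the length of its facial walk. An edge which the walk passes on both of
its sides counts twice. -/
noncomputable def faceLength (R : G.RotationSystem) (F : R.Face) : ℕ :=
  Nat.card {d : E × Bool // R.faceOf d = F}

/-- The number of negative edges around a face, for a choice `κ` of signs of the edges, counted in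
the same way as in `faceLength`. -/
noncomputable def negatives (R : G.RotationSystem) (κ : E → ℤˣ) (F : R.Face) : ℕ :=
  Nat.card {d : E × Bool // R.faceOf d = F ∧ κ d.1 = -1}

/-- The rotation system describes an embedding in the plane (equivalently, in the sphere): every
connected component `K` that has an edge satisfies Euler's formula `V - E + F = 2`, where `V`, `E`
and `F` are its numbers of vertices, edges and faces. An isolated vertex is no restriction. -/
def IsPlane (R : G.RotationSystem) : Prop :=
  ∀ K : G.toSimpleGraph.ConnectedComponent,
    (∃ e : E, G.toSimpleGraph.connectedComponentMk (Sum.inl (G.black e)) = K) →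
    Nat.card {v : B ⊕ W // G.toSimpleGraph.connectedComponentMk v = K} +
        Nat.card {F : R.Face //
          ∃ d, R.faceOf d = F ∧ G.toSimpleGraph.connectedComponentMk (G.origin d) = K} =
      Nat.card {e : E // G.toSimpleGraph.connectedComponentMk (Sum.inl (G.black e)) = K} + 2

/-- A Kasteleyn weighting: a choice of sign for each edge such that the number of negatives around
each face is odd if the face has length `0 mod 4` and even if the face has length `2 mod 4`.
(Every face of a bipartite graph has even length.) -/
def IsKasteleyn (R : G.RotationSystem) (κ : E → ℤˣ) : Prop :=
  ∀ F : R.Face,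
    (R.faceLength F % 4 = 0 → Odd (R.negatives κ F)) ∧
      (R.faceLength F % 4 = 2 → Even (R.negatives κ F))

end RotationSystem

/-- A perfect matching: a set of edges such that every vertex is the end of exactly one of them. -/
def IsPerfectMatching (G : BipartiteGraph B W E) (μ : Finset E) : Prop :=
  (∀ b : B, ∃! e : E, e ∈ μ ∧ G.black e = b) ∧ (∀ w : W, ∃! e : E, e ∈ μ ∧ G.white e = w)

/-- The set of edges `μ` joins the `i`-th vertex of the first vertex set to the `σ i`-th vertex of
the second, and contains no other edges. Here the vertices of the two sets are numbered by `β` and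
`ω`. -/
def MatchesVia {n : ℕ} (G : BipartiteGraph B W E) (β : Fin n ≃ B) (ω : Fin n ≃ W)
    (σ : Equiv.Perm (Fin n)) (μ : Finset E) : Prop :=
  ∀ e ∈ μ, ∃ i : Fin n, G.black e = β i ∧ G.white e = ω (σ i)

/-- All perfect matchings. -/
noncomputable def perfectMatchings [Fintype E] (G : BipartiteGraph B W E) : Finset (Finset E) :=
  open Classical in Finset.univ.filter fun μ => G.IsPerfectMatching μ

/-- The perfect matchings that match the `i`-th vertex of the first vertex set to the `σ i`-th
vertex of the second vertex set, for all `i`. Without multiple edges there is at most one. -/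
noncomputable def perfectMatchingsVia [Fintype E] {n : ℕ} (G : BipartiteGraph B W E)
    (β : Fin n ≃ B) (ω : Fin n ≃ W) (σ : Equiv.Perm (Fin n)) : Finset (Finset E) :=
  open Classical in G.perfectMatchings.filter fun μ => G.MatchesVia β ω σ μ

/-- The (unsigned) monomial of a set of edges: the product of their formal variables. -/
noncomputable def monomial (μ : Finset E) : MvPolynomial E ℤ :=
  ∏ e ∈ μ, MvPolynomial.X e

/-- The signed bipartite adjacency submatrix, with the formal variable `X e` in place of the usual
`1` for each edge `e`, and with the signs `κ`. The rows are the vertices of the first vertex set and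
the columns those of the second, in the orders `β` and `ω`; multiple edges are added up. -/
noncomputable def signedMatrix [Fintype E] {n : ℕ} (G : BipartiteGraph B W E)
    (κ : E → ℤˣ) (β : Fin n ≃ B) (ω : Fin n ≃ W) :
    Matrix (Fin n) (Fin n) (MvPolynomial E ℤ) :=
  open Classical in fun i j =>
    ∑ e ∈ Finset.univ.filter (fun e : E => G.black e = β i ∧ G.white e = ω j),
      MvPolynomial.C ((κ e : ℤˣ) : ℤ) * MvPolynomial.X e

end BipartiteGraph

/-- The term of the permutation `σ` in the determinant expansion of the matrix `M`. -/
def detTerm {n : ℕ} {R : Type*} [CommRing R] (M : Matrix (Fin n) (Fin n) R)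
    (σ : Equiv.Perm (Fin n)) : R :=
  ((Equiv.Perm.sign σ : ℤˣ) : ℤ) * ∏ i, M i (σ i)

/-- The determinant is the sum of these terms. -/
theorem det_eq_sum_detTerm {n : ℕ} {R : Type*} [CommRing R] (M : Matrix (Fin n) (Fin n) R) :
    M.det = ∑ σ : Equiv.Perm (Fin n), detTerm M σ := by
  rw [← Matrix.det_transpose, Matrix.det_apply']
  rfl


/-!
The Kasteleyn condition says that certain signs of the darts, which change when a dart is reversed,
multiply to `-1` along every face. Given two perfect matchings, detach from their vertices, one
after the other, the darts of all edges outside both matchings. Each detachment multiplies the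
rotation by a transposition; it keeps the embedding plane, and it affects at most one face of each
component. Since the sign of the face permutation is the product of the signs of the rotation and of
the reversal, the numbers of vertices and edges of the component determine the product of the
dart signs over all its faces. Hence, after the signs of the detached darts have been reversed, the
product along the affected face is `-1` again. In the end the faces through darts of the matchings
alternate between the two matchings, and that each of them has product `-1` means that the two
matchings have the same signed weight.
-/

section Classes

variable {D : Type*} {r t : Setoid D} {x y : D}

/-- The equivalence relation obtained from `r` by uniting the classes of `x` and `y`. -/
def mergeClasses (r : Setoid D) (x y : D) : Setoid D where
  r a b := r a b ∨ (r a x ∨ r a y) ∧ (r b x ∨ r b y)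
  iseqv := by
    refine ⟨fun a => Or.inl (r.refl a), ?_, ?_⟩
    · rintro a b (h | ⟨ha, hb⟩)
      · exact Or.inl (r.symm h)
      · exact Or.inr ⟨hb, ha⟩
    · rintro a b c (hab | ⟨ha, hb⟩) (hbc | ⟨hb', hc⟩)
      · exact Or.inl (r.trans hab hbc)
      · exact Or.inr ⟨hb'.imp (r.trans hab) (r.trans hab), hc⟩
      · exact Or.inr ⟨ha, hb.imp (r.trans (r.symm hbc)) (r.trans (r.symm hbc))⟩
      · exact Or.inr ⟨ha, hc⟩

theorem le_mergeClasses (r : Setoid D) (x y : D) : r ≤ mergeClasses r x y := fun _ _ => Or.inl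

theorem mergeClasses_rel (r : Setoid D) (x y : D) : mergeClasses r x y x y :=
  Or.inr ⟨Or.inl (r.refl x), Or.inr (r.refl y)⟩

theorem mergeClasses_le_iff : mergeClasses r x y ≤ t ↔ r ≤ t ∧ t x y := by
  refine ⟨fun h => ⟨(le_mergeClasses r x y).trans h, h (mergeClasses_rel r x y)⟩, ?_⟩
  rintro ⟨hrt, hxy⟩ a b (hab | ⟨ha, hb⟩)
  · exact hrt hab
  · have to_x : ∀ c, r c x ∨ r c y → t c x := fun c hc =>
      hc.elim (fun hcx => hrt hcx) fun hcy => t.trans (hrt hcy) (t.symm hxy)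
    exact t.trans (to_x a ha) (t.symm (to_x b hb))

theorem mergeClasses_eq_self (h : r x y) : mergeClasses r x y = r :=
  le_antisymm (mergeClasses_le_iff.2 ⟨le_rfl, h⟩) (le_mergeClasses r x y)

theorem mergeClasses_sup (r t : Setoid D) (x y : D) :
    mergeClasses r x y ⊔ t = mergeClasses (r ⊔ t) x y := by
  refine le_antisymm (sup_le (mergeClasses_le_iff.2 ⟨?_, mergeClasses_rel _ x y⟩) ?_)
    (mergeClasses_le_iff.2 ⟨sup_le_sup_right (le_mergeClasses r x y) t, ?_⟩)
  · exact le_sup_left.trans (le_mergeClasses _ x y)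
  · exact le_sup_right.trans (le_mergeClasses _ x y)
  · exact (le_sup_left : mergeClasses r x y ≤ _ ⊔ t) (mergeClasses_rel r x y)

/-- The number of classes of an equivalence relation, `0` if there are infinitely many. -/
noncomputable def numClasses (r : Setoid D) : ℕ := Nat.card (Quotient r)

theorem numClasses_mergeClasses [Finite D] (h : ¬ r x y) :
    numClasses (mergeClasses r x y) + 1 = numClasses r := by
  let f : {q : Quotient r // q ≠ Quotient.mk r y} → Quotient (mergeClasses r x y) :=
    fun q => Setoid.map_of_le (le_mergeClasses r x y) q
  have hf : Function.Bijective f := by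
    constructor
    · rintro ⟨⟨a⟩, ha⟩ ⟨⟨b⟩, hb⟩ hab
      have ha : ¬ r a y := fun h => ha (Quotient.sound h)
      have hb : ¬ r b y := fun h => hb (Quotient.sound h)
      rcases Quotient.exact hab with hab | ⟨hax, hbx⟩
      · exact Subtype.ext (Quotient.sound hab)
      · exact Subtype.ext (Quotient.sound
          (r.trans (hax.resolve_right ha) (r.symm (hbx.resolve_right hb))))
    · rintro ⟨a⟩
      by_cases ha : r a y
      · exact ⟨⟨Quotient.mk r x, fun e => h (Quotient.exact e)⟩,
          Quotient.sound (Or.inr ⟨Or.inl (r.refl x), Or.inr ha⟩)⟩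
      · exact ⟨⟨Quotient.mk r a, fun e => ha (Quotient.exact e)⟩, rfl⟩
  rw [numClasses, ← Nat.card_eq_of_bijective f hf, numClasses]
  exact Set.ncard_add_ncard_compl {Quotient.mk r y} ▸ by
    rw [Set.ncard_singleton, add_comm]; rfl

theorem numClasses_eq_sum_ncard [Finite D] [Fintype (Quotient t)] (h : r ≤ t) :
    numClasses r = ∑ q : Quotient t, (Quotient.mk r '' {a | Quotient.mk t a = q}).ncard := by
  have : Finite (Quotient r) := inferInstance
  rw [numClasses, ← Nat.card_congr (Equiv.sigmaFiberEquiv (Setoid.map_of_le h)), Nat.card_sigma]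
  refine Finset.sum_congr rfl fun q _ => ?_
  rw [← Nat.card_coe_set_eq]
  refine Nat.card_congr (Equiv.setCongr (Set.ext ?_))
  rintro ⟨a⟩
  exact ⟨fun ha => ⟨a, ha, rfl⟩, fun ⟨_, hb, hba⟩ => hba ▸ hb⟩

theorem ncard_image_eq_of_eq_iff_eq {A A' : Type*} {f : D → A} {g : D → A'}
    (h : ∀ a b, f a = f b ↔ g a = g b) (s : Set D) : (f '' s).ncard = (g '' s).ncard := by
  have hker : Setoid.ker (s.domRestrict f) = Setoid.ker (s.domRestrict g) :=
    Setoid.ext fun a b => h a b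
  rw [← Set.range_domRestrict, ← Set.range_domRestrict, ← Nat.card_coe_set_eq,
    ← Nat.card_coe_set_eq, ← Nat.card_congr (Setoid.quotientKerEquivRange _), hker,
    Nat.card_congr (Setoid.quotientKerEquivRange _)]

end Classes

section Cycles

open Equiv Perm

variable {D : Type*}

theorem sameCycleSetoid_apply (f : Perm D) (a : D) : SameCycle.setoid f a (f a) :=
  sameCycle_apply_right.2 (SameCycle.refl f a)

theorem sameCycleSetoid_le_iff {f : Perm D} {t : Setoid D} :
    SameCycle.setoid f ≤ t ↔ ∀ a, t a (f a) := by
  refine ⟨fun h a => h (sameCycleSetoid_apply f a), ?_⟩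
  rintro h a b ⟨k, hk⟩
  induction k generalizing a with
  | zero => exact hk ▸ t.refl a
  | succ k ih => exact t.trans (h a) (ih (by rwa [zpow_add_one] at hk))
  | pred k ih =>
    have hinv : t (f⁻¹ a) a := by
      simpa only [← Perm.mul_apply, mul_inv_cancel, Perm.one_apply] using h (f⁻¹ a)
    exact t.trans (t.symm hinv) (ih (by rwa [zpow_sub_one] at hk))

theorem sameCycle_iff_of_involutive {f : Perm D} (hf : Function.Involutive f) {a b : D} :
    f.SameCycle a b ↔ b = a ∨ b = f a := by
  constructor
  · rintro ⟨k, rfl⟩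
    have hsq : f ^ (2 : ℤ) = 1 := Perm.ext fun a => hf a
    rcases Int.even_or_odd' k with ⟨j, rfl | rfl⟩
    · exact Or.inl (by rw [zpow_mul, hsq, one_zpow, Perm.one_apply])
    · exact Or.inr (by rw [zpow_add, zpow_mul, hsq, one_zpow, one_mul, zpow_one])
  · rintro (rfl | rfl)
    · exact SameCycle.refl f b
    · exact sameCycleSetoid_apply f a

theorem sameCycle_iff_of_semiconj {T : Type*} [Finite T] [Finite D] {f : Perm D} {g : Perm T}
    {i : T → D} (hi : Function.Injective i) (h : Function.Semiconj i g f) {s t : T} :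
    g.SameCycle s t ↔ f.SameCycle (i s) (i t) := by
  have hpow (k : ℕ) : i ((g ^ k) s) = (f ^ k) (i s) := by
    simpa only [iterate_eq_pow] using (h.iterate_right k).eq s
  constructor
  · intro hst
    obtain ⟨k, rfl⟩ := hst.exists_nat_pow_eq
    exact ⟨k, by rw [zpow_natCast, hpow]⟩
  · intro hst
    obtain ⟨k, hk⟩ := hst.exists_nat_pow_eq
    exact ⟨k, hi (by rw [zpow_natCast, hpow, hk])⟩

/-- The number of cycles of a permutation of a finite type, fixed points included. -/
noncomputable def numCycles (f : Perm D) : ℕ := numClasses (SameCycle.setoid f)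

theorem numCycles_one : numCycles (1 : Perm D) = Nat.card D :=
  (Nat.card_eq_of_bijective (Quotient.mk (SameCycle.setoid (1 : Perm D)))
    ⟨fun _ _ h => sameCycle_one.1 (Quotient.exact h), Quotient.mk_surjective⟩).symm

theorem two_mul_numCycles_of_involutive [Finite D] {f : Perm D} (hf : Function.Involutive f)
    (hne : ∀ a, f a ≠ a) : 2 * numCycles f = Nat.card D := by
  have := Fintype.ofFinite (Quotient (SameCycle.setoid f))
  have hfiber (q : Quotient (SameCycle.setoid f)) :
      Nat.card {a // Quotient.mk (SameCycle.setoid f) a = q} = 2 := by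
    induction q using Quotient.inductionOn with | h a => ?_
    have hpair : {b | Quotient.mk (SameCycle.setoid f) b = Quotient.mk _ a} = {a, f a} :=
      Set.ext fun b => Quotient.eq.trans (sameCycle_comm.trans (sameCycle_iff_of_involutive hf))
    exact (congrArg Set.ncard hpair).trans (Set.ncard_pair (hne a).symm)
  rw [← Nat.card_congr (Equiv.sigmaFiberEquiv (Quotient.mk (SameCycle.setoid f))),
    Nat.card_sigma, Finset.sum_congr rfl fun q _ => hfiber q, Finset.sum_const, numCycles,
    numClasses, Nat.card_eq_fintype_card, Finset.card_univ, smul_eq_mul, mul_comm]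

variable [DecidableEq D]

theorem sameCycleSetoid_le_mergeClasses_swap_mul (f : Perm D) (x y : D) :
    SameCycle.setoid f ≤ mergeClasses (SameCycle.setoid (swap x y * f)) x y := by
  refine sameCycleSetoid_le_iff.2 fun a => ?_
  have h : SameCycle.setoid (swap x y * f) a (swap x y (f a)) := sameCycleSetoid_apply _ a
  rcases eq_or_ne (f a) x with hx | hx
  · rw [hx, swap_apply_left] at h
    exact Or.inr ⟨Or.inr h, Or.inl (hx ▸ Setoid.refl' _ _)⟩
  rcases eq_or_ne (f a) y with hy | hy
  · rw [hy, swap_apply_right] at h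
    exact Or.inr ⟨Or.inl h, Or.inr (hy ▸ Setoid.refl' _ _)⟩
  · rw [swap_apply_of_ne_of_ne hx hy] at h
    exact Or.inl h

theorem sameCycleSetoid_swap_mul_le_mergeClasses (f : Perm D) (x y : D) :
    SameCycle.setoid (swap x y * f) ≤ mergeClasses (SameCycle.setoid f) x y := by
  simpa using sameCycleSetoid_le_mergeClasses_swap_mul (swap x y * f) x y

theorem mergeClasses_swap_mul (f : Perm D) (x y : D) :
    mergeClasses (SameCycle.setoid (swap x y * f)) x y = mergeClasses (SameCycle.setoid f) x y :=
  le_antisymm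
    (mergeClasses_le_iff.2
      ⟨sameCycleSetoid_swap_mul_le_mergeClasses f x y, mergeClasses_rel _ x y⟩)
    (mergeClasses_le_iff.2
      ⟨sameCycleSetoid_le_mergeClasses_swap_mul f x y, mergeClasses_rel _ x y⟩)

theorem sameCycle_swap_mul_iff_of_not_sameCycle {f : Perm D} {x y a b : D}
    (hx : ¬ (swap x y * f).SameCycle a x) (hy : ¬ (swap x y * f).SameCycle a y) :
    (swap x y * f).SameCycle a b ↔ f.SameCycle a b := by
  have of_f {c : D} (h : f.SameCycle a c) : (swap x y * f).SameCycle a c :=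
    (sameCycleSetoid_le_mergeClasses_swap_mul f x y h).resolve_right fun h => h.1.elim hx hy
  refine ⟨fun h => ?_, of_f⟩
  exact (sameCycleSetoid_swap_mul_le_mergeClasses f x y h).resolve_right fun h =>
    h.1.elim (fun h => hx (of_f h)) fun h => hy (of_f h)

/-- The permutation obtained from `f` by removing `x` from its cycle, so that `x` becomes a fixed
point. -/
def detach (f : Perm D) (x : D) : Perm D := swap x (f x) * f

theorem detach_apply_self (f : Perm D) (x : D) : detach f x x = x := by simp [detach]

theorem mergeClasses_detach (f : Perm D) (x : D) :
    mergeClasses (SameCycle.setoid (detach f x)) x (f x) = SameCycle.setoid f :=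
  (mergeClasses_swap_mul f x (f x)).trans (mergeClasses_eq_self (sameCycleSetoid_apply f x))

theorem sameCycle_detach_iff {f : Perm D} {x a b : D} :
    (detach f x).SameCycle a b ↔ a = x ∧ b = x ∨ a ≠ x ∧ b ≠ x ∧ f.SameCycle a b := by
  have from_x {c : D} (h : (detach f x).SameCycle x c) : c = x :=
    (h.eq_of_left (detach_apply_self f x)).symm
  have hf : f.SameCycle a b ↔ _ := Setoid.ext_iff.1 (mergeClasses_detach f x).symm a b
  by_cases ha : a = x
  · subst ha
    exact ⟨fun h => Or.inl ⟨rfl, from_x h⟩, fun h => h.elim (fun h => h.2 ▸ .rfl) (by tauto)⟩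
  by_cases hb : b = x
  · subst hb
    exact ⟨fun h => absurd (from_x h.symm) ha, by tauto⟩
  · simp only [ha, hb, false_and, false_or, ne_eq, not_false_eq_true, true_and, hf]
    refine ⟨Or.inl, ?_⟩
    rintro (h | ⟨hax | hax, hbx | hbx⟩)
    exacts [h, absurd (from_x hax.symm) ha, absurd (from_x hax.symm) ha,
      absurd (from_x hbx.symm) hb, hax.trans hbx.symm]

variable [Finite D]

theorem numCycles_detach {f : Perm D} {x : D} (h : f x ≠ x) :
    numCycles (detach f x) = numCycles f + 1 := by
  have hx : ¬ (detach f x).SameCycle x (f x) := by simp [sameCycle_detach_iff, h]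
  rw [numCycles, numCycles, ← numClasses_mergeClasses hx, mergeClasses_detach]

@[elab_as_elim]
theorem detach_induction {p : Perm D → Prop} (f : Perm D) (one : p 1)
    (of_detach : ∀ f x, f x ≠ x → p (detach f x) → p f) : p f := by
  have := Fintype.ofFinite D
  induction hn : f.support.card using Nat.strong_induction_on generalizing f with
  | _ n ih =>
    by_cases hf : f = 1
    · exact hf ▸ one
    · obtain ⟨x, hx⟩ : ∃ x, f x ≠ x := not_forall.1 fun h => hf (Perm.ext h)
      exact of_detach f x hx (ih _ (hn ▸ card_support_swap_mul hx) _ rfl)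

theorem sign_eq_neg_one_pow [Fintype D] (f : Perm D) :
    sign f = (-1) ^ (Fintype.card D + numCycles f) := by
  induction f using detach_induction with
  | one => rw [numCycles_one, Nat.card_eq_fintype_card, Perm.sign_one, Even.neg_one_pow ⟨_, rfl⟩]
  | of_detach f x hx ih =>
    rw [numCycles_detach hx, detach, Perm.sign_mul, sign_swap hx.symm, ← add_assoc, pow_succ] at ih
    simpa using ih

theorem sameCycle_swap_mul_iff_not {f : Perm D} {x y : D} (hxy : x ≠ y) :
    (swap x y * f).SameCycle x y ↔ ¬ f.SameCycle x y := by
  have := Fintype.ofFinite D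
  have hnum : numCycles (swap x y * f) ≠ numCycles f := fun h => by
    have hsign := sign_eq_neg_one_pow (swap x y * f)
    rw [h, ← sign_eq_neg_one_pow f, Perm.sign_mul, sign_swap hxy] at hsign
    simp at hsign
  have hmerge := congrArg numClasses (mergeClasses_swap_mul f x y)
  by_contra! hiff
  rcases hiff with ⟨hg, hf⟩ | ⟨hg, hf⟩
  · rw [mergeClasses_eq_self hg, mergeClasses_eq_self hf] at hmerge
    exact hnum hmerge
  · exact hnum ((numClasses_mergeClasses hg).symm.trans
      ((congrArg (· + 1) hmerge).trans (numClasses_mergeClasses hf)))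

theorem numCycles_swap_mul {f : Perm D} {x y : D} (h : ¬ f.SameCycle x y) :
    numCycles (swap x y * f) + 1 = numCycles f := by
  have hxy : x ≠ y := fun e => h (e ▸ SameCycle.refl f x)
  have hg : (swap x y * f).SameCycle x y := (sameCycle_swap_mul_iff_not hxy).2 h
  have hmerge := mergeClasses_swap_mul f x y
  rw [mergeClasses_eq_self hg] at hmerge
  rw [numCycles, hmerge, numClasses_mergeClasses h, numCycles]

theorem numCycles_swap_mul_of_sameCycle {f : Perm D} {x y : D} (hxy : x ≠ y)
    (h : f.SameCycle x y) : numCycles (swap x y * f) = numCycles f + 1 := by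
  have hg : ¬ (swap x y * f).SameCycle x y := by rwa [sameCycle_swap_mul_iff_not hxy, not_not]
  simpa using (numCycles_swap_mul hg).symm

end Cycles

section CycleProd

open Equiv Perm

variable {D : Type*} [Fintype D] {f g : Perm D} {u v : D → ℤˣ} {a b : D}

open Classical in
/-- The product of the signs `u` along the cycle of `f` that contains `a`. -/
noncomputable def cycleProd (f : Perm D) (u : D → ℤˣ) (a : D) : ℤˣ :=
  ∏ b with f.SameCycle a b, u b

theorem cycleProd_congr (hfg : ∀ b, f.SameCycle a b ↔ g.SameCycle a b)
    (huv : ∀ b, f.SameCycle a b → u b = v b) : cycleProd f u a = cycleProd g v a := by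
  classical
  exact Finset.prod_congr (Finset.filter_congr fun b _ => hfg b) fun b hb =>
    huv b ((hfg b).2 (Finset.mem_filter.1 hb).2)

theorem cycleProd_eq_of_sameCycle (u : D → ℤˣ) (h : f.SameCycle a b) :
    cycleProd f u a = cycleProd f u b := by
  classical
  exact Finset.prod_congr (Finset.filter_congr fun c _ => ⟨h.symm.trans, h.trans⟩) fun _ _ => rfl

theorem cycleProd_of_semiconj {T : Type*} [Fintype T] {g : Perm T} {i : T → D}
    (hi : Function.Injective i) (h : Function.Semiconj i g f) (u : D → ℤˣ) (t : T) :
    cycleProd g (u ∘ i) t = cycleProd f u (i t) := by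
  classical
  refine Finset.prod_nbij i (fun s hs => ?_) hi.injOn (fun b hb => ?_) fun _ _ => rfl
  · simpa [sameCycle_iff_of_semiconj hi h] using hs
  · obtain ⟨k, rfl⟩ := (Finset.mem_filter.1 hb).2.exists_nat_pow_eq
    refine ⟨(g ^ k) t, by simp [SameCycle.refl], ?_⟩
    simpa only [iterate_eq_pow] using (h.iterate_right k).eq t

theorem cycleProd_eq_neg_one_of_involutive (hf : Function.Involutive f) (hne : ∀ a, f a ≠ a)
    (hu : ∀ a, u (f a) = -u a) (a : D) : cycleProd f u a = -1 := by
  classical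
  have hcycle : (Finset.univ.filter fun b => f.SameCycle a b) = {a, f a} := by
    ext b
    simp [sameCycle_iff_of_involutive hf]
  calc cycleProd f u a = ∏ b ∈ {a, f a}, u b := Finset.prod_congr hcycle fun _ _ => rfl
    _ = -1 := by rw [Finset.prod_pair (hne a).symm, hu, mul_neg, Int.units_mul_self]

theorem prod_eq_prod_quotient (f : Perm D) [Fintype (Quotient (SameCycle.setoid f))]
    (u : D → ℤˣ) :
    ∏ a, u a = ∏ q : Quotient (SameCycle.setoid f), cycleProd f u q.out := by
  classical
  rw [← Finset.prod_fiberwise Finset.univ (Quotient.mk (SameCycle.setoid f))]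
  refine Finset.prod_congr rfl fun q _ => Finset.prod_congr (Finset.filter_congr fun b _ => ?_)
    fun _ _ => rfl
  exact ⟨fun h => Quotient.exact (q.out_eq.trans h.symm),
    fun h => (Quotient.sound h).symm.trans q.out_eq⟩

theorem prod_eq_neg_one_pow_mul_neg_cycleProd (x : D)
    (h : ∀ a, ¬ f.SameCycle x a → cycleProd f u a = -1) :
    ∏ a, u a = (-1) ^ numCycles f * -cycleProd f u x := by
  have := Fintype.ofFinite (Quotient (SameCycle.setoid f))
  have hfactor :
      ∏ q : Quotient (SameCycle.setoid f), -cycleProd f u q.out = -cycleProd f u x := by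
    have hx := Quotient.mk_out (s := SameCycle.setoid f) x
    rw [Fintype.prod_eq_single (Quotient.mk _ x) fun q hq => ?_, cycleProd_eq_of_sameCycle u hx]
    have hxq : ¬ f.SameCycle x q.out := fun e => hq (q.out_eq.symm.trans (Quotient.sound e.symm))
    rw [h _ hxq, neg_neg]
  rw [← hfactor, Finset.prod_neg, prod_eq_prod_quotient f u, Finset.card_univ, numCycles,
    numClasses, Nat.card_eq_fintype_card, ← mul_assoc, ← mul_pow, neg_one_mul, neg_neg, one_pow,
    one_mul]

theorem prod_eq_neg_one_pow_numCycles (h : ∀ a, cycleProd f u a = -1) :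
    ∏ a, u a = (-1) ^ numCycles f := by
  have := Fintype.ofFinite (Quotient (SameCycle.setoid f))
  rw [prod_eq_prod_quotient f, Finset.prod_congr rfl fun q _ => h _, Finset.prod_const,
    Finset.card_univ, numCycles, numClasses, Nat.card_eq_fintype_card]

theorem sign_sumComm (ι : Type*) [Fintype ι] [DecidableEq ι] :
    sign (Equiv.sumComm ι ι : Perm (ι ⊕ ι)) = (-1) ^ Fintype.card ι := by
  have hcard := two_mul_numCycles_of_involutive (f := Equiv.sumComm ι ι) Sum.swap_swap
    (by rintro (i | i) <;> simp)
  rw [Nat.card_eq_fintype_card, Fintype.card_sum, ← two_mul] at hcard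
  rw [sign_eq_neg_one_pow, Fintype.card_sum, Nat.eq_of_mul_eq_mul_left two_pos hcard, pow_add,
    Even.neg_one_pow ⟨_, rfl⟩, one_mul]

theorem prod_mul_prod_eq_of_alternating {ι : Type*} [Fintype ι] [DecidableEq ι]
    (hu : ∀ a, cycleProd f u a = -1) {b w : ι → D} (hb : Function.Injective b)
    (hw : Function.Injective w) (hbw : ∀ i j, b i ≠ w j) {π : Perm ι}
    (hfb : ∀ i, f (b i) = w (π i)) (hfw : ∀ i, f (w i) = b i) :
    (∏ i, u (b i)) * ∏ i, u (w i) = (-1) ^ Fintype.card ι * sign π := by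
  let ρ : Perm (ι ⊕ ι) := Equiv.sumComm ι ι * sumCongr π 1
  have hsemi : Function.Semiconj (Sum.elim b w) ρ f := by
    rintro (i | i)
    exacts [(hfb i).symm, (hfw i).symm]
  have hρ : ∀ t, cycleProd ρ (u ∘ Sum.elim b w) t = -1 := fun t =>
    (cycleProd_of_semiconj (hb.sumElim hw hbw) hsemi u t).trans (hu _)
  calc
    (∏ i, u (b i)) * ∏ i, u (w i) = ∏ t, (u ∘ Sum.elim b w) t := by
      rw [Fintype.prod_sum_type]; rfl
    _ = (-1) ^ numCycles ρ := prod_eq_neg_one_pow_numCycles hρ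
    _ = sign ρ := by
      rw [sign_eq_neg_one_pow, Fintype.card_sum, pow_add, Even.neg_one_pow ⟨_, rfl⟩, one_mul]
    _ = (-1) ^ Fintype.card ι * sign π := by
      rw [Perm.sign_mul, sign_sumComm, sign_sumCongr, Perm.sign_one, mul_one]

end CycleProd

open Equiv Perm in
/-- A graph drawn on closed oriented surfaces, one for each of its components, given on the set of
its darts (directed edges): `vertex` takes a dart to the next one that starts from the same vertex,
and `edge` reverses a dart. -/
structure CombinatorialMap (D : Type*) where
  vertex : Perm D
  edge : Perm D
  edge_involutive : Function.Involutive edge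
  edge_ne : ∀ a, edge a ≠ a

namespace CombinatorialMap

open Equiv Perm

variable {D : Type*} (M : CombinatorialMap D)

/-- The permutation of the darts whose cycles are the faces. -/
def face : Perm D := M.vertex * M.edge

/-- The equivalence relation on the darts whose classes are the connected components. -/
def component : Setoid D := SameCycle.setoid M.vertex ⊔ SameCycle.setoid M.edge

/-- Twice the sum of the genera of the components. -/
noncomputable def eulerGenus : ℤ :=
  2 * numClasses M.component + numCycles M.edge - numCycles M.vertex - numCycles M.face

/-- All components are drawn on the sphere. -/
def IsPlanar : Prop := M.eulerGenus = 0

theorem component_vertex (a : D) : M.component a (M.vertex a) :=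
  (le_sup_left : _ ≤ M.component) (sameCycleSetoid_apply M.vertex a)

theorem component_edge (a : D) : M.component a (M.edge a) :=
  (le_sup_right : _ ≤ M.component) (sameCycleSetoid_apply M.edge a)

theorem face_le_component : SameCycle.setoid M.face ≤ M.component :=
  sameCycleSetoid_le_iff.2 fun a =>
    M.component.trans (M.component_edge a) (M.component_vertex (M.edge a))

section Detach

variable [DecidableEq D]

/-- The map obtained by making the dart `x` start from a new vertex, of degree one. -/
def detach (x : D) : CombinatorialMap D := { M with vertex := _root_.detach M.vertex x }

theorem detach_of_vertex_eq {x : D} (h : M.vertex x = x) : M.detach x = M := by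
  simp only [detach, _root_.detach, h, swap_self]
  rfl

theorem detach_face (x : D) : (M.detach x).face = swap x (M.vertex x) * M.face :=
  mul_assoc _ _ _

theorem mergeClasses_component_detach (x : D) :
    mergeClasses (M.detach x).component x (M.vertex x) = M.component :=
  (mergeClasses_sup _ _ _ _).symm.trans
    (congrArg (· ⊔ SameCycle.setoid M.edge) (mergeClasses_detach M.vertex x))

open Classical in
theorem eulerGenus_eq_eulerGenus_detach_add [Finite D] {x : D} (hx : M.vertex x ≠ x) :
    M.eulerGenus = (M.detach x).eulerGenus +
      if (M.detach x).component x (M.vertex x) ∧ ¬ (M.detach x).face.SameCycle x (M.vertex x)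
      then 2 else 0 := by
  have hvertex : numCycles (M.detach x).vertex = numCycles M.vertex + 1 := numCycles_detach hx
  have hface : M.face = swap x (M.vertex x) * (M.detach x).face := by
    rw [detach_face, swap_mul_self_mul]
  have hcomp := M.mergeClasses_component_detach x
  have hedge : (M.detach x).edge = M.edge := rfl
  unfold eulerGenus
  rw [hvertex, hedge]
  by_cases hf : (M.detach x).face.SameCycle x (M.vertex x)
  · have hc := (M.detach x).face_le_component hf
    rw [mergeClasses_eq_self hc] at hcomp
    rw [hface, numCycles_swap_mul_of_sameCycle hx.symm hf, if_neg fun h => h.2 hf, hcomp]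
    push_cast
    ring
  · have hnum := numCycles_swap_mul hf
    rw [← hface] at hnum
    rw [← hnum]
    by_cases hc : (M.detach x).component x (M.vertex x)
    · rw [mergeClasses_eq_self hc] at hcomp
      rw [if_pos ⟨hc, hf⟩, hcomp]
      push_cast
      ring
    · rw [← numClasses_mergeClasses hc, if_neg fun h => hc h.1, hcomp]
      push_cast
      ring

end Detach

section Planar

variable [Finite D]

theorem eulerGenus_nonneg : 0 ≤ M.eulerGenus := by
  classical
  obtain ⟨vertex, edge, hedge, hne⟩ := M
  induction vertex using detach_induction with
  | one =>
    have hcomp : SameCycle.setoid (1 : Perm D) ⊔ SameCycle.setoid edge = SameCycle.setoid edge :=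
      sup_eq_right.2 (sameCycleSetoid_le_iff.2 fun a => Setoid.refl' _ a)
    have hcard := two_mul_numCycles_of_involutive hedge hne
    rw [eulerGenus, component, hcomp, face, one_mul, numCycles_one, ← hcard, numCycles]
    push_cast
    linarith
  | of_detach vertex x hx ih =>
    rw [eulerGenus_eq_eulerGenus_detach_add _ hx]
    refine add_nonneg ih ?_
    split_ifs <;> norm_num

variable {M} [DecidableEq D]

theorem IsPlanar.detach (hM : M.IsPlanar) (x : D) : (M.detach x).IsPlanar := by
  by_cases hx : M.vertex x = x
  · rwa [M.detach_of_vertex_eq hx]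
  · have h := M.eulerGenus_eq_eulerGenus_detach_add hx
    have hnonneg := (M.detach x).eulerGenus_nonneg
    rw [hM] at h
    unfold IsPlanar
    split_ifs at h <;> omega

theorem IsPlanar.sameCycle_face_detach (hM : M.IsPlanar) {x : D}
    (h : (M.detach x).component x (M.vertex x)) :
    (M.detach x).face.SameCycle x (M.vertex x) := by
  by_cases hx : M.vertex x = x
  · rw [hx]
  · by_contra hf
    have hgenus := M.eulerGenus_eq_eulerGenus_detach_add hx
    have hnonneg := (M.detach x).eulerGenus_nonneg
    rw [hM, if_pos ⟨h, hf⟩] at hgenus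
    omega

end Planar

/-- Exactly one dart of `m` starts from each vertex. -/
def IsTransversal (m : Set D) : Prop := ∀ a, ∃! b, b ∈ m ∧ M.vertex.SameCycle a b

open Classical in
/-- The signs `u`, reversed at the darts in `m` whose reverse is not in `m`. -/
noncomputable def twist (m : Set D) (u : D → ℤˣ) (a : D) : ℤˣ :=
  if a ∈ m ∧ M.edge a ∉ m then -u a else u a

/-- The signs `u` of the darts multiply to `-1` along every face. -/
def IsKasteleyn [Fintype D] (u : D → ℤˣ) : Prop := ∀ a, cycleProd M.face u a = -1

variable {M} {m m' : Set D} {u : D → ℤˣ} {x : D}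

theorem twist_eq_self (hm : ∀ a ∈ m, M.edge a ∈ m) : M.twist m u = u :=
  funext fun a => if_neg fun h => h.2 (hm a h.1)

namespace IsTransversal

theorem eq_of_vertex_mem (hm : M.IsTransversal m) {a : D} (ha : a ∈ m) (hva : M.vertex a ∈ m) :
    M.vertex a = a :=
  (hm a).unique ⟨hva, sameCycleSetoid_apply M.vertex a⟩ ⟨ha, SameCycle.refl _ a⟩

theorem mem_of_vertex_eq (hm : M.IsTransversal m) {a : D} (ha : M.vertex a = a) : a ∈ m := by
  obtain ⟨b, ⟨hb, hab⟩, -⟩ := hm a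
  exact hab.eq_of_left ha ▸ hb

theorem numCycles_vertex (hm : M.IsTransversal m) : numCycles M.vertex = m.ncard := by
  refine (Nat.card_eq_of_bijective
    (fun b : m => Quotient.mk (SameCycle.setoid M.vertex) (b : D)) ⟨fun b c hbc => ?_, ?_⟩).symm
  · exact Subtype.ext ((hm b).unique ⟨b.2, SameCycle.refl _ _⟩ ⟨c.2, Quotient.exact hbc⟩)
  · rintro ⟨a⟩
    obtain ⟨b, ⟨hb, hab⟩, -⟩ := hm a
    exact ⟨⟨b, hb⟩, Quotient.sound hab.symm⟩

protected theorem detach [DecidableEq D] (hm : M.IsTransversal m) (hx : x ∉ m) :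
    (M.detach x).IsTransversal (insert x m) := by
  intro a
  simp only [CombinatorialMap.detach, sameCycle_detach_iff]
  by_cases ha : a = x
  · exact ⟨x, by simp [ha], by simp [ha]⟩
  · obtain ⟨b, ⟨hb, hab⟩, hunique⟩ := hm a
    refine ⟨b, ⟨Or.inr hb, Or.inr ⟨ha, fun e => hx (e ▸ hb), hab⟩⟩, ?_⟩
    rintro c ⟨hc, ⟨hax, -⟩ | ⟨-, hcx, hac⟩⟩
    exacts [absurd hax ha, hunique c ⟨hc.resolve_left hcx, hac⟩]

theorem vertex_mem (hm : M.IsTransversal ((m ∪ m')ᶜ ∪ m))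
    (hm' : M.IsTransversal ((m ∪ m')ᶜ ∪ m')) {a : D} (ha : a ∈ m) : M.vertex a ∈ m' := by
  by_cases hva : M.vertex a ∈ (m ∪ m')ᶜ ∪ m
  · have hfix := hm.eq_of_vertex_mem (Or.inr ha) hva
    rw [hfix]
    exact (hm'.mem_of_vertex_eq hfix).resolve_left fun h => h (Or.inl ha)
  · by_contra hva'
    exact hva (or_iff_not_imp_right.2 fun h h' => h'.elim h hva')

end IsTransversal

section Kasteleyn

variable [Fintype D]

theorem prod_twist (hu : ∀ a, u (M.edge a) = -u a) (hm : M.IsTransversal m) :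
    ∏ a, M.twist m u a = (-1) ^ numCycles M.face := by
  classical
  have hedge : ∏ a, u a = (-1) ^ numCycles M.edge := prod_eq_neg_one_pow_numCycles
    (cycleProd_eq_neg_one_of_involutive M.edge_involutive M.edge_ne hu)
  have hinner : ∏ a, (if a ∈ m ∧ M.edge a ∈ m then -1 else 1 : ℤˣ) = 1 :=
    Finset.prod_involution (fun a _ => M.edge a)
      (fun a _ => by
        simp only [M.edge_involutive a, and_comm (a := M.edge a ∈ m)]
        split_ifs <;> rfl) (fun a _ _ => M.edge_ne a) (by simp)
      fun a _ => M.edge_involutive a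
  have hvertex : ∏ a, (if a ∈ m then -1 else 1 : ℤˣ) = (-1) ^ numCycles M.vertex := by
    rw [hm.numCycles_vertex, Finset.prod_ite, Finset.prod_const_one, mul_one, Finset.prod_const,
      ← Set.ncard_coe_finset, Finset.coe_filter_univ, Set.ofPred_mem_eq]
  have hsign : sign M.face = sign M.vertex * sign M.edge := Perm.sign_mul _ _
  have hcard : (-1 : ℤˣ) ^ Fintype.card D = 1 := by
    rw [← Nat.card_eq_fintype_card,
      ← two_mul_numCycles_of_involutive M.edge_involutive M.edge_ne, pow_mul, neg_one_sq, one_pow]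
  simp only [sign_eq_neg_one_pow, pow_add, hcard, one_mul] at hsign
  calc ∏ a, M.twist m u a = ∏ a, (if a ∈ m ∧ M.edge a ∈ m then -1 else 1) *
        (if a ∈ m then -1 else 1) * u a := Finset.prod_congr rfl fun a _ => by
          by_cases ha : a ∈ m <;> by_cases hea : M.edge a ∈ m <;> simp [twist, ha, hea]
    _ = (-1) ^ numCycles M.face := by
      rw [Finset.prod_mul_distrib, Finset.prod_mul_distrib, hinner, one_mul, hvertex, hedge, hsign]

theorem cycleProd_twist_eq_neg_one_of_forall (hu : ∀ a, u (M.edge a) = -u a)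
    (hm : M.IsTransversal m)
    (h : ∀ a, ¬ M.face.SameCycle x a → cycleProd M.face (M.twist m u) a = -1) :
    cycleProd M.face (M.twist m u) x = -1 := by
  have hprod := prod_eq_neg_one_pow_mul_neg_cycleProd x h
  rw [prod_twist hu hm, eq_comm, mul_eq_left] at hprod
  rw [← neg_neg (cycleProd _ _ _), hprod]

end Kasteleyn

section Restrict

variable (M)

theorem component_vertex_iff (x a : D) : M.component x (M.vertex a) ↔ M.component x a :=
  ⟨fun h => M.component.trans h (M.component.symm (M.component_vertex a)),
    fun h => M.component.trans h (M.component_vertex a)⟩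

theorem component_edge_iff (x a : D) : M.component x (M.edge a) ↔ M.component x a :=
  ⟨fun h => M.component.trans h (M.component.symm (M.component_edge a)),
    fun h => M.component.trans h (M.component_edge a)⟩

/-- The connected component of the dart `x`. -/
def restrict (x : D) : CombinatorialMap {a // M.component x a} where
  vertex := M.vertex.subtypePerm (M.component_vertex_iff x)
  edge := M.edge.subtypePerm (M.component_edge_iff x)
  edge_involutive a := Subtype.ext (M.edge_involutive a)
  edge_ne a h := M.edge_ne a (congrArg Subtype.val h)

theorem semiconj_val_face_restrict (x : D) :
    Function.Semiconj Subtype.val (M.restrict x).face M.face := fun _ => rfl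

theorem twist_restrict (x : D) (m : Set D) (u : D → ℤˣ) :
    (M.restrict x).twist (Subtype.val ⁻¹' m) (u ∘ Subtype.val) = M.twist m u ∘ Subtype.val := rfl

variable {M}

theorem sameCycle_vertex_restrict {a b : {a // M.component x a}} :
    (M.restrict x).vertex.SameCycle a b ↔ M.vertex.SameCycle a b :=
  sameCycle_subtypePerm (h := M.component_vertex_iff x)

protected theorem IsTransversal.restrict (hm : M.IsTransversal m) (x : D) :
    (M.restrict x).IsTransversal (Subtype.val ⁻¹' m) := by
  intro a
  obtain ⟨b, ⟨hb, hab⟩, hunique⟩ := hm a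
  have hxb : M.component x b := M.component.trans a.2 ((le_sup_left : _ ≤ M.component) hab)
  refine ⟨⟨b, hxb⟩, ⟨hb, sameCycle_vertex_restrict.2 hab⟩, ?_⟩
  rintro c ⟨hc, hac⟩
  exact Subtype.ext (hunique c ⟨hc, sameCycle_vertex_restrict.1 hac⟩)

theorem cycleProd_twist_eq_neg_one_of_component [Fintype D] (hu : ∀ a, u (M.edge a) = -u a)
    (hm : M.IsTransversal m) (h : ∀ a, M.component x a → ¬ M.face.SameCycle x a →
      cycleProd M.face (M.twist m u) a = -1) :
    cycleProd M.face (M.twist m u) x = -1 := by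
  classical
  have hcycleProd (a : {a // M.component x a}) : cycleProd (M.restrict x).face
      ((M.restrict x).twist (Subtype.val ⁻¹' m) (u ∘ Subtype.val)) a =
        cycleProd M.face (M.twist m u) a := by
    rw [twist_restrict]
    exact cycleProd_of_semiconj Subtype.val_injective (M.semiconj_val_face_restrict x) _ a
  rw [← hcycleProd ⟨x, M.component.refl x⟩]
  refine cycleProd_twist_eq_neg_one_of_forall (fun a => hu a) (hm.restrict x) fun a ha => ?_
  rw [hcycleProd]
  rw [sameCycle_iff_of_semiconj Subtype.val_injective (M.semiconj_val_face_restrict x)] at ha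
  exact h a a.2 ha

end Restrict

section Reduction

variable [Fintype D]

theorem cycleProd_face_detach [DecidableEq D] {a : D}
    (hx : ¬ (M.detach x).face.SameCycle a x)
    (hy : ¬ (M.detach x).face.SameCycle a (M.vertex x)) :
    cycleProd (M.detach x).face ((M.detach x).twist (insert x m) u) a =
      cycleProd M.face (M.twist m u) a := by
  have hedge : (M.detach x).face.SameCycle (M.edge x) x :=
    ⟨1, by simp [detach, face, M.edge_involutive x, detach_apply_self]⟩
  refine cycleProd_congr (fun b => ?_) fun b hab => ?_
  · rw [detach_face] at hx hy ⊢
    exact sameCycle_swap_mul_iff_of_not_sameCycle hx hy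
  · have hbx : b ≠ x := fun e => hx (e ▸ hab)
    have hebx : M.edge b ≠ x := fun e =>
      hx ((M.edge_involutive.eq_iff.1 e ▸ hab).trans hedge)
    have hinsert {c : D} (hc : c ≠ x) : c ∈ insert x m ↔ c ∈ m :=
      Set.mem_insert_iff.trans (or_iff_right hc)
    have hiff : b ∈ insert x m ∧ (M.detach x).edge b ∉ insert x m ↔ b ∈ m ∧ M.edge b ∉ m :=
      and_congr (hinsert hbx) (not_congr (hinsert hebx))
    by_cases h : b ∈ m ∧ M.edge b ∉ m
    · rw [twist, twist, if_pos h, if_pos (hiff.2 h)]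
    · rw [twist, twist, if_neg h, if_neg (mt hiff.1 h)]

theorem IsKasteleyn.detach [DecidableEq D] (hM : M.IsPlanar) (hu : ∀ a, u (M.edge a) = -u a)
    (hm : M.IsTransversal m) (hK : M.IsKasteleyn (M.twist m u)) (hx : x ∉ m) :
    (M.detach x).IsKasteleyn ((M.detach x).twist (insert x m) u) := by
  have unchanged {a : D} (ha : ¬ (M.detach x).face.SameCycle a x)
      (ha' : ¬ (M.detach x).face.SameCycle a (M.vertex x)) :
      cycleProd (M.detach x).face ((M.detach x).twist (insert x m) u) a = -1 :=
    (cycleProd_face_detach ha ha').trans (hK a)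
  -- By planarity, a component has at most one face through `x` or `M.vertex x`.
  have unique {a b c d : D} (hc : c = x ∨ c = M.vertex x) (hd : d = x ∨ d = M.vertex x)
      (hac : (M.detach x).face.SameCycle a c) (hbd : (M.detach x).face.SameCycle b d)
      (hab : (M.detach x).component a b) : (M.detach x).face.SameCycle a b := by
    have hle := (M.detach x).face_le_component
    have hcd : (M.detach x).component c d :=
      Setoid.trans' _ (Setoid.symm' _ (hle hac)) (Setoid.trans' _ hab (hle hbd))
    suffices h : (M.detach x).face.SameCycle c d from hac.trans (h.trans hbd.symm)
    rcases hc with rfl | rfl <;> rcases hd with rfl | rfl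
    exacts [.refl _ _, hM.sameCycle_face_detach hcd,
      (hM.sameCycle_face_detach ((M.detach _).component.symm hcd)).symm, .refl _ _]
  intro a
  by_cases ha : ∃ c, (c = x ∨ c = M.vertex x) ∧ (M.detach x).face.SameCycle a c
  · obtain ⟨c, hc, hac⟩ := ha
    refine cycleProd_twist_eq_neg_one_of_component hu (hm.detach hx) fun b hab hb => ?_
    exact unchanged (fun h => hb (unique hc (Or.inl rfl) hac h hab))
      fun h => hb (unique hc (Or.inr rfl) hac h hab)
  · exact unchanged (fun h => ha ⟨x, Or.inl rfl, h⟩) fun h => ha ⟨_, Or.inr rfl, h⟩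

theorem exists_detach_finset (hM : M.IsPlanar) (hu : ∀ a, u (M.edge a) = -u a) (s : Finset D) :
    ∃ N : CombinatorialMap D, N.IsPlanar ∧ N.edge = M.edge ∧
      SameCycle.setoid N.vertex ≤ SameCycle.setoid M.vertex ∧
      ∀ m, Disjoint (s : Set D) m → M.IsTransversal m → N.IsTransversal (s ∪ m) ∧
        (M.IsKasteleyn (M.twist m u) → N.IsKasteleyn (N.twist (s ∪ m) u)) := by
  classical
  induction s using Finset.induction_on with
  | empty => exact ⟨M, hM, rfl, le_rfl, fun m _ hm => by simp [hm]⟩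
  | insert x s hxs ih =>
    obtain ⟨N, hN, hedge, hvertex, hNm⟩ := ih
    have hle : SameCycle.setoid (N.detach x).vertex ≤ SameCycle.setoid N.vertex :=
      (le_mergeClasses _ _ _).trans (mergeClasses_detach N.vertex x).le
    refine ⟨N.detach x, hN.detach x, hedge, hle.trans hvertex, fun m hsm hm => ?_⟩
    rw [Finset.coe_insert, Set.disjoint_insert_left] at hsm
    obtain ⟨hNtrans, hNK⟩ := hNm m hsm.2 hm
    have hx : x ∉ (s : Set D) ∪ m := fun h => h.elim hxs hsm.1
    rw [Finset.coe_insert, Set.insert_union]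
    exact ⟨hNtrans.detach hx, fun hK =>
      (hNK hK).detach hN (fun a => hedge ▸ hu a) hNtrans hx⟩

theorem exists_reduction (hM : M.IsPlanar) (hu : ∀ a, u (M.edge a) = -u a)
    (hm : M.IsTransversal m) (hm' : M.IsTransversal m') (hme : ∀ a, M.edge a ∈ m ↔ a ∈ m)
    (hme' : ∀ a, M.edge a ∈ m' ↔ a ∈ m') (hK : M.IsKasteleyn u) :
    ∃ N : CombinatorialMap D, N.edge = M.edge ∧
      SameCycle.setoid N.vertex ≤ SameCycle.setoid M.vertex ∧
      (∀ a ∈ m, N.vertex a ∈ m') ∧ (∀ a ∈ m', N.vertex a ∈ m) ∧ N.IsKasteleyn u := by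
  classical
  obtain ⟨N, -, hedge, hvertex, hN⟩ := exists_detach_finset hM hu (m ∪ m')ᶜ.toFinset
  simp only [Set.coe_toFinset] at hN
  obtain ⟨hNm, hNK⟩ := hN m (disjoint_compl_left.mono_right Set.subset_union_left) hm
  obtain ⟨hNm', -⟩ := hN m' (disjoint_compl_left.mono_right Set.subset_union_right) hm'
  refine ⟨N, hedge, hvertex, fun a => hNm.vertex_mem hNm', fun a => ?_, ?_⟩
  · rw [Set.union_comm m m'] at hNm hNm'
    exact hNm'.vertex_mem hNm
  · rw [twist_eq_self fun a => (hme a).2] at hNK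
    have hclosed : ∀ a ∈ (m ∪ m')ᶜ ∪ m, N.edge a ∈ (m ∪ m')ᶜ ∪ m := fun a => by
      simp only [hedge, Set.mem_union, Set.mem_compl_iff, hme, hme', imp_self]
    rw [twist_eq_self hclosed] at hNK
    exact hNK hK

end Reduction

end CombinatorialMap

namespace BipartiteGraph

variable {B W E : Type*} {G : BipartiteGraph B W E}

theorem reversal_involutive : Function.Involutive (reversal E) :=
  fun d => Prod.ext rfl (Bool.not_not d.2)

theorem reversal_ne (d : E × Bool) : reversal E d ≠ d :=
  fun h => Bool.not_ne_self d.2 (congrArg Prod.snd h)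

theorem sameCycle_reversal_iff {d d' : E × Bool} :
    (reversal E).SameCycle d d' ↔ d.1 = d'.1 := by
  rw [sameCycle_iff_of_involutive reversal_involutive]
  obtain ⟨e, _ | _⟩ := d <;> obtain ⟨e', _ | _⟩ := d' <;> simp [reversal, eq_comm]

theorem snd_eq_of_origin_eq {d d' : E × Bool} (h : G.origin d = G.origin d') : d.2 = d'.2 := by
  obtain ⟨e, _ | _⟩ := d <;> obtain ⟨e', _ | _⟩ := d' <;> simp_all [origin]

/-- The signs of the darts for which the Kasteleyn condition says that the product along every face
is `-1`: those of the edges, with a minus sign for the darts that start from a black vertex. -/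
def dartSign (κ : E → ℤˣ) (d : E × Bool) : ℤˣ := if d.2 then κ d.1 else -κ d.1

theorem dartSign_reversal (κ : E → ℤˣ) (d : E × Bool) :
    dartSign κ (reversal E d) = -dartSign κ d := by
  obtain ⟨e, _ | _⟩ := d <;> simp [reversal, dartSign]

theorem toSimpleGraph_adj_reversal (d : E × Bool) :
    G.toSimpleGraph.Adj (G.origin d) (G.origin (reversal E d)) := by
  obtain ⟨e, _ | _⟩ := d
  · exact (SimpleGraph.fromRel_adj _ _ _).2 ⟨Sum.inl_ne_inr, Or.inl ⟨e, rfl, rfl⟩⟩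
  · exact (SimpleGraph.fromRel_adj _ _ _).2 ⟨Sum.inr_ne_inl, Or.inr ⟨e, rfl, rfl⟩⟩

theorem exists_dart_of_adj {v v' : B ⊕ W} (h : G.toSimpleGraph.Adj v v') :
    ∃ d, G.origin d = v ∧ G.origin (reversal E d) = v' := by
  rcases (SimpleGraph.fromRel_adj _ _ _).1 h with ⟨-, ⟨e, rfl, rfl⟩ | ⟨e, rfl, rfl⟩⟩
  exacts [⟨(e, false), rfl, rfl⟩, ⟨(e, true), rfl, rfl⟩]

/-- The darts that lie in the connected component `K`. -/
def dartsIn (G : BipartiteGraph B W E) (K : G.toSimpleGraph.ConnectedComponent) : Set (E × Bool) :=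
  {d | G.toSimpleGraph.connectedComponentMk (G.origin d) = K}

theorem fst_image_dartsIn (K : G.toSimpleGraph.ConnectedComponent) :
    Prod.fst '' G.dartsIn K =
      {e | G.toSimpleGraph.connectedComponentMk (Sum.inl (G.black e)) = K} := by
  ext e
  constructor
  · rintro ⟨⟨e, _ | _⟩, rfl, rfl⟩
    exacts [rfl, SimpleGraph.ConnectedComponent.sound
      (toSimpleGraph_adj_reversal (G := G) (e, false)).reachable]
  · exact fun he => ⟨(e, false), he, rfl⟩

theorem origin_image_dartsIn (d : E × Bool) :
    G.origin '' G.dartsIn (G.toSimpleGraph.connectedComponentMk (G.origin d)) =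
      {v | G.toSimpleGraph.connectedComponentMk v =
        G.toSimpleGraph.connectedComponentMk (G.origin d)} := by
  ext v
  constructor
  · rintro ⟨d', hd', rfl⟩
    exact hd'
  · intro hv
    obtain ⟨_ | ⟨h, _⟩⟩ := SimpleGraph.ConnectedComponent.exact hv
    · exact ⟨d, rfl, rfl⟩
    · obtain ⟨d', rfl, -⟩ := exists_dart_of_adj h
      exact ⟨d', hv, rfl⟩

namespace RotationSystem

open Equiv.Perm

variable (R : G.RotationSystem)

/-- The combinatorial map of a rotation system; its faces are the facial walks of `R`. -/
def toMap : CombinatorialMap (E × Bool) where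
  vertex := R.next
  edge := reversal E
  edge_involutive := reversal_involutive
  edge_ne := reversal_ne

theorem origin_next (d : E × Bool) : G.origin (R.next d) = G.origin d :=
  ((R.sameCycle_iff d (R.next d)).1 (sameCycleSetoid_apply R.next d)).symm

theorem snd_facePerm (d : E × Bool) : (R.facePerm d).2 = !d.2 :=
  snd_eq_of_origin_eq (R.origin_next (reversal E d))

theorem exists_dart_of_walk {v v' : B ⊕ W} (p : G.toSimpleGraph.Walk v v') (d : E × Bool)
    (hd : G.origin d = v) : ∃ d', G.origin d' = v' ∧ R.toMap.component d d' := by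
  induction p generalizing d with
  | nil => exact ⟨d, hd, Setoid.refl' _ d⟩
  | cons h _ ih =>
    obtain ⟨c, rfl, hc⟩ := exists_dart_of_adj h
    obtain ⟨d', hd', hcd'⟩ := ih _ hc
    have hdc : R.toMap.component d c :=
      (le_sup_left : _ ≤ R.toMap.component) ((R.sameCycle_iff d c).2 hd)
    exact ⟨d', hd', Setoid.trans' _ hdc (Setoid.trans' _ (R.toMap.component_edge c) hcd')⟩

theorem mem_dartsIn_iff {d d' : E × Bool} :
    d' ∈ G.dartsIn (G.toSimpleGraph.connectedComponentMk (G.origin d)) ↔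
      R.toMap.component d' d := by
  constructor
  · intro h
    obtain ⟨p⟩ := SimpleGraph.ConnectedComponent.exact h
    obtain ⟨c, hc, hdc⟩ := R.exists_dart_of_walk p d' rfl
    exact Setoid.trans' _ hdc
      ((le_sup_left : _ ≤ R.toMap.component) ((R.sameCycle_iff c d).2 hc))
  · have hle : R.toMap.component ≤
        Setoid.ker fun d => G.toSimpleGraph.connectedComponentMk (G.origin d) :=
      sup_le (sameCycleSetoid_le_iff.2 fun d => congrArg _ (R.origin_next d).symm)
        (sameCycleSetoid_le_iff.2 fun d =>
          SimpleGraph.ConnectedComponent.sound (toSimpleGraph_adj_reversal d).reachable)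
    exact fun h => hle h

variable {R}

theorem IsPlane.ncard_image_dartsIn (hR : R.IsPlane) (d : E × Bool) :
    let S := G.dartsIn (G.toSimpleGraph.connectedComponentMk (G.origin d))
    (G.origin '' S).ncard + (R.faceOf '' S).ncard = (Prod.fst '' S).ncard + 2 := by
  intro S
  obtain ⟨e, he⟩ : (Prod.fst '' S).Nonempty := ⟨d.1, d, rfl, rfl⟩
  rw [fst_image_dartsIn] at he
  have hfaces : R.faceOf '' S = {F | ∃ d', R.faceOf d' = F ∧
      G.toSimpleGraph.connectedComponentMk (G.origin d') =
        G.toSimpleGraph.connectedComponentMk (G.origin d)} :=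
    Set.ext fun F => exists_congr fun _ => and_comm
  rw [origin_image_dartsIn, fst_image_dartsIn, hfaces]
  exact hR _ ⟨e, he⟩

theorem IsPlane.isPlanar [Finite E] (hR : R.IsPlane) : R.toMap.IsPlanar := by
  have := Fintype.ofFinite (Quotient R.toMap.component)
  have hone : numClasses R.toMap.component = ∑ _q : Quotient R.toMap.component, 1 := by
    rw [numClasses, Nat.card_eq_fintype_card, Finset.sum_const, smul_eq_mul, mul_one,
      Finset.card_univ]
  have hvertex_le : SameCycle.setoid R.toMap.vertex ≤ R.toMap.component := le_sup_left
  have hedge_le : SameCycle.setoid R.toMap.edge ≤ R.toMap.component := le_sup_right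
  have hcount : numCycles R.toMap.vertex + numCycles R.toMap.face =
      numCycles R.toMap.edge + 2 * numClasses R.toMap.component := by
    rw [numCycles, numCycles, numCycles, hone,
      numClasses_eq_sum_ncard hvertex_le, numClasses_eq_sum_ncard hedge_le,
      numClasses_eq_sum_ncard R.toMap.face_le_component, Finset.mul_sum,
      ← Finset.sum_add_distrib, ← Finset.sum_add_distrib]
    refine Finset.sum_congr rfl fun q _ => ?_
    induction q using Quotient.inductionOn with | h d
    have hS : {d' | Quotient.mk R.toMap.component d' = Quotient.mk _ d} =
        G.dartsIn (G.toSimpleGraph.connectedComponentMk (G.origin d)) :=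
      Set.ext fun d' => Quotient.eq.trans R.mem_dartsIn_iff.symm
    rw [hS]
    rw [ncard_image_eq_of_eq_iff_eq fun a b => Quotient.eq.trans (R.sameCycle_iff a b),
      ncard_image_eq_of_eq_iff_eq (f := Quotient.mk (SameCycle.setoid R.toMap.edge))
        fun _ _ => Quotient.eq.trans sameCycle_reversal_iff]
    exact hR.ncard_image_dartsIn d
  unfold CombinatorialMap.IsPlanar CombinatorialMap.eulerGenus
  omega

theorem faceOf_eq_faceOf_iff {d d' : E × Bool} :
    R.faceOf d' = R.faceOf d ↔ R.facePerm.SameCycle d d' :=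
  Quotient.eq.trans sameCycle_comm

theorem faceLength_eq_two_mul [Finite E] (F : R.Face) :
    R.faceLength F = 2 * {d | R.faceOf d = F ∧ d.2 = false}.ncard := by
  set S : Set (E × Bool) := {d | R.faceOf d = F ∧ d.2 = false}
  have hface (d : E × Bool) : R.faceOf (R.facePerm d) = R.faceOf d :=
    faceOf_eq_faceOf_iff.2 (sameCycleSetoid_apply R.facePerm d)
  have himage : R.facePerm '' S = {d | R.faceOf d = F ∧ d.2 = true} := by
    rw [Equiv.image_eq_preimage_symm]
    ext d
    obtain ⟨c, rfl⟩ := R.facePerm.surjective d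
    simp [S, hface, snd_facePerm]
  have hunion : {d | R.faceOf d = F} = S ∪ R.facePerm '' S := by
    rw [himage]
    ext d
    cases h : d.2 <;> simp [S, h]
  have hdisj : Disjoint S (R.facePerm '' S) := by
    rw [himage]
    exact Set.disjoint_left.2 fun d hd hd' => Bool.false_ne_true (hd.2.symm.trans hd'.2)
  calc R.faceLength F = (S ∪ R.facePerm '' S).ncard := congrArg Set.ncard hunion
    _ = 2 * S.ncard := by
      rw [Set.ncard_union_eq hdisj, Set.ncard_image_of_injective _ R.facePerm.injective, two_mul]

variable [Fintype E]

theorem cycleProd_dartSign (κ : E → ℤˣ) (d : E × Bool) :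
    cycleProd R.facePerm (dartSign κ) d =
      (-1) ^ {d' | R.faceOf d' = R.faceOf d ∧ d'.2 = false}.ncard *
        (-1) ^ R.negatives κ (R.faceOf d) := by
  classical
  have hcount (p : E × Bool → Prop) [DecidablePred p] :
      cycleProd R.facePerm (fun c => if p c then -1 else 1) d =
        (-1) ^ {d' | R.faceOf d' = R.faceOf d ∧ p d'}.ncard := by
    rw [cycleProd, Finset.prod_ite, Finset.prod_const_one, mul_one, Finset.prod_const,
      Finset.filter_filter, ← Set.ncard_coe_finset, Finset.coe_filter_univ]
    simp only [faceOf_eq_faceOf_iff]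
  have hsign (c : E × Bool) : dartSign κ c =
      (if c.2 = false then -1 else 1) * if κ c.1 = -1 then -1 else 1 := by
    rcases Int.units_eq_one_or (κ c.1) with h | h <;> cases hc : c.2 <;> simp [dartSign, h, hc]
  calc cycleProd R.facePerm (dartSign κ) d
      = cycleProd R.facePerm (fun c => if c.2 = false then -1 else 1) d *
          cycleProd R.facePerm (fun c => if κ c.1 = -1 then -1 else 1) d :=
        (Finset.prod_congr rfl fun c _ => hsign c).trans Finset.prod_mul_distrib
    _ = _ := by rw [hcount, hcount]; rfl

theorem IsKasteleyn.isKasteleyn_toMap {κ : E → ℤˣ} (hκ : R.IsKasteleyn κ) :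
    R.toMap.IsKasteleyn (dartSign κ) := by
  intro d
  obtain ⟨hzero, htwo⟩ := hκ (R.faceOf d)
  rw [faceLength_eq_two_mul] at hzero htwo
  refine (cycleProd_dartSign κ d).trans ?_
  rcases Nat.even_or_odd {d' | R.faceOf d' = R.faceOf d ∧ d'.2 = false}.ncard with h | h
  · have hodd := hzero (by obtain ⟨k, hk⟩ := h; omega)
    rw [h.neg_one_pow, hodd.neg_one_pow, one_mul]
  · have heven := htwo (by obtain ⟨k, hk⟩ := h; omega)
    rw [h.neg_one_pow, heven.neg_one_pow, mul_one]

end RotationSystem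

section Matchings

variable {n : ℕ} {β : Fin n ≃ B} {ω : Fin n ≃ W} {σ σ' : Equiv.Perm (Fin n)} {μ : Finset E}

theorem IsPerfectMatching.existsUnique_dart (hμ : G.IsPerfectMatching μ) (d : E × Bool) :
    ∃! d' : E × Bool, d'.1 ∈ μ ∧ G.origin d = G.origin d' := by
  obtain ⟨e, _ | _⟩ := d
  · obtain ⟨e', ⟨he', h⟩, hunique⟩ := hμ.1 (G.black e)
    refine ⟨(e', false), ⟨he', congrArg Sum.inl h.symm⟩, ?_⟩
    rintro ⟨c, _ | _⟩ ⟨hc, hec⟩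
    · rw [hunique c ⟨hc, (Sum.inl_injective hec).symm⟩]
    · exact absurd hec Sum.inl_ne_inr
  · obtain ⟨e', ⟨he', h⟩, hunique⟩ := hμ.2 (G.white e)
    refine ⟨(e', true), ⟨he', congrArg Sum.inr h.symm⟩, ?_⟩
    rintro ⟨c, _ | _⟩ ⟨hc, hec⟩
    · exact absurd hec Sum.inr_ne_inl
    · rw [hunique c ⟨hc, (Sum.inr_injective hec).symm⟩]

theorem IsPerfectMatching.isTransversal (hμ : G.IsPerfectMatching μ) (R : G.RotationSystem) :
    R.toMap.IsTransversal {d | d.1 ∈ μ} := fun d =>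
  (existsUnique_congr fun d' => and_congr_right' (R.sameCycle_iff d d')).2 (hμ.existsUnique_dart d)

theorem IsPerfectMatching.existsUnique_matchesVia (hμ : G.IsPerfectMatching μ)
    (β : Fin n ≃ B) (ω : Fin n ≃ W) : ∃! σ : Equiv.Perm (Fin n), G.MatchesVia β ω σ μ := by
  choose p hp hunique using fun i => hμ.1 (β i)
  have hinj : Function.Injective fun i => ω.symm (G.white (p i)) := by
    intro i j hij
    have h := (hμ.2 (G.white (p i))).unique ⟨(hp i).1, rfl⟩
      ⟨(hp j).1, (ω.symm.injective hij).symm⟩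
    exact β.injective (by rw [← (hp i).2, h, (hp j).2])
  refine ⟨Equiv.ofBijective _ (Finite.injective_iff_bijective.1 hinj), fun e he => ?_,
    fun τ hτ => ?_⟩
  · have hpe : e = p (β.symm (G.black e)) := hunique _ e ⟨he, by simp⟩
    exact ⟨β.symm (G.black e), by simp, by simp [← hpe]⟩
  · ext1 i
    obtain ⟨j, hj, hj'⟩ := hτ _ (hp i).1
    obtain rfl := β.injective ((hp i).2.symm.trans hj)
    simp [hj']

/-- The edges `p i` join the `i`-th vertex of the first vertex set to the `σ i`-th vertex of the
second: the enumerated form of a perfect matching that induces `σ`. -/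
def IsEdgeChoice (G : BipartiteGraph B W E) (β : Fin n ≃ B) (ω : Fin n ≃ W)
    (σ : Equiv.Perm (Fin n)) (p : Fin n → E) : Prop :=
  ∀ i, G.black (p i) = β i ∧ G.white (p i) = ω (σ i)

namespace IsEdgeChoice

variable {p p' : Fin n → E}

theorem injective (hp : G.IsEdgeChoice β ω σ p) : Function.Injective p := fun i j hij =>
  β.injective (by rw [← (hp i).1, hij, (hp j).1])

theorem isPerfectMatching [DecidableEq E] (hp : G.IsEdgeChoice β ω σ p) :
    G.IsPerfectMatching (Finset.univ.image p) := by
  refine ⟨fun b => ⟨p (β.symm b), ⟨by simp, by simp [(hp _).1]⟩, ?_⟩,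
    fun w => ⟨p (σ.symm (ω.symm w)), ⟨by simp, by simp [(hp _).2]⟩, ?_⟩⟩
  · rintro e ⟨he, rfl⟩
    obtain ⟨i, -, rfl⟩ := Finset.mem_image.1 he
    simp [(hp i).1]
  · rintro e ⟨he, rfl⟩
    obtain ⟨i, -, rfl⟩ := Finset.mem_image.1 he
    simp [(hp i).2]

theorem matchesVia [DecidableEq E] (hp : G.IsEdgeChoice β ω σ p) :
    G.MatchesVia β ω σ (Finset.univ.image p) := by
  intro e he
  obtain ⟨i, -, rfl⟩ := Finset.mem_image.1 he
  exact ⟨i, hp i⟩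

theorem eq_of_image_eq [DecidableEq E] (hp : G.IsEdgeChoice β ω σ p)
    (hp' : G.IsEdgeChoice β ω σ' p') (h : Finset.univ.image p = Finset.univ.image p') :
    p = p' := by
  ext1 i
  obtain ⟨j, -, hj⟩ := Finset.mem_image.1 (h ▸ Finset.mem_image_of_mem p (Finset.mem_univ i))
  have hij : β j = β i := by rw [← (hp' j).1, hj, (hp i).1]
  rw [← hj, β.injective hij]

end IsEdgeChoice

theorem IsPerfectMatching.exists_isEdgeChoice [DecidableEq E] (hμ : G.IsPerfectMatching μ)
    (hσ : G.MatchesVia β ω σ μ) : ∃ p, G.IsEdgeChoice β ω σ p ∧ Finset.univ.image p = μ := by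
  choose p hp hunique using fun i => hμ.1 (β i)
  refine ⟨p, fun i => ⟨(hp i).2, ?_⟩, Finset.ext fun e => ⟨fun he => ?_, fun he => ?_⟩⟩
  · obtain ⟨j, hj, hj'⟩ := hσ _ (hp i).1
    rw [hj', β.injective ((hp i).2.symm.trans hj)]
  · obtain ⟨i, -, rfl⟩ := Finset.mem_image.1 he
    exact (hp i).1
  · have hpe : e = p (β.symm (G.black e)) := hunique _ e ⟨he, by simp⟩
    exact hpe ▸ Finset.mem_image_of_mem p (Finset.mem_univ _)

namespace IsEdgeChoice

variable {R : G.RotationSystem} {κ : E → ℤˣ} {p p' : Fin n → E}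

theorem exists_alternating_perm [Fintype E] (hR : R.IsPlane) (hκ : R.IsKasteleyn κ)
    (hp : G.IsEdgeChoice β ω σ p) (hp' : G.IsEdgeChoice β ω σ' p') :
    ∃ f : Equiv.Perm (E × Bool), (∀ d, cycleProd f (dartSign κ) d = -1) ∧
      (∀ i, f (p i, false) = (p' ((σ'⁻¹ * σ) i), true)) ∧
      ∀ i, f (p' i, true) = (p i, false) := by
  classical
  have hμ := hp.isPerfectMatching
  have hμ' := hp'.isPerfectMatching
  obtain ⟨N, hedge, hvertex, hN, hN', hK⟩ := CombinatorialMap.exists_reduction hR.isPlanar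
    (dartSign_reversal κ) (hμ.isTransversal R) (hμ'.isTransversal R) (fun _ => Iff.rfl)
    (fun _ => Iff.rfl) hκ.isKasteleyn_toMap
  have horigin (d : E × Bool) : G.origin d = G.origin (N.vertex d) :=
    (R.sameCycle_iff _ _).1 (hvertex (sameCycleSetoid_apply N.vertex d))
  have hmem (q : Fin n → E) (i : Fin n) : q i ∈ Finset.univ.image q :=
    Finset.mem_image_of_mem q (Finset.mem_univ i)
  refine ⟨N.face, hK, fun i => ?_, fun i => ?_⟩ <;> rw [CombinatorialMap.face, hedge]
  · have hend : G.origin (p i, true) = G.origin (p' ((σ'⁻¹ * σ) i), true) := by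
      simp [origin, (hp i).2, (hp' _).2]
    exact (hμ'.existsUnique_dart (p i, true)).unique ⟨hN (p i, true) (hmem p i), horigin _⟩
      ⟨hmem p' _, hend⟩
  · have hend : G.origin (p' i, false) = G.origin (p i, false) := by
      simp [origin, (hp i).1, (hp' i).1]
    exact (hμ.existsUnique_dart (p' i, false)).unique ⟨hN' (p' i, false) (hmem p' i), horigin _⟩
      ⟨hmem p i, hend⟩

theorem sign_mul_prod_eq [Finite E] (hR : R.IsPlane) (hκ : R.IsKasteleyn κ)
    (hp : G.IsEdgeChoice β ω σ p) (hp' : G.IsEdgeChoice β ω σ' p') :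
    Equiv.Perm.sign σ * ∏ i, κ (p i) = Equiv.Perm.sign σ' * ∏ i, κ (p' i) := by
  have := Fintype.ofFinite E
  obtain ⟨f, hf, hblack, hwhite⟩ := exists_alternating_perm hR hκ hp hp'
  have hprod := prod_mul_prod_eq_of_alternating hf
    ((Prod.mk_left_injective false).comp hp.injective)
    ((Prod.mk_left_injective true).comp hp'.injective) (fun _ _ => by simp) hblack hwhite
  have hsigns : (∏ i, κ (p i)) * ∏ i, κ (p' i) = Equiv.Perm.sign σ' * Equiv.Perm.sign σ := by
    simpa [dartSign, Finset.prod_neg, mul_assoc] using hprod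
  rw [mul_comm, ← div_eq_div_iff_mul_eq_mul, Int.units_div_eq_mul, Int.units_div_eq_mul, hsigns]

end IsEdgeChoice

theorem IsSimple.eq_of_matchesVia (hG : G.IsSimple) {μ' : Finset E} (hμ : G.IsPerfectMatching μ)
    (hσ : G.MatchesVia β ω σ μ) (hμ' : G.IsPerfectMatching μ') (hσ' : G.MatchesVia β ω σ μ') :
    μ = μ' := by
  classical
  obtain ⟨p, hp, rfl⟩ := hμ.exists_isEdgeChoice hσ
  obtain ⟨p', hp', rfl⟩ := hμ'.exists_isEdgeChoice hσ'
  rw [funext fun i => hG (p i) (p' i) ((hp i).1.trans (hp' i).1.symm)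
    ((hp i).2.trans (hp' i).2.symm)]

variable [Fintype E]

theorem mem_perfectMatchings : μ ∈ G.perfectMatchings ↔ G.IsPerfectMatching μ := by
  simp [perfectMatchings]

theorem mem_perfectMatchingsVia :
    μ ∈ G.perfectMatchingsVia β ω σ ↔ G.IsPerfectMatching μ ∧ G.MatchesVia β ω σ μ := by
  simp [perfectMatchingsVia, mem_perfectMatchings]

theorem exists_sign {R : G.RotationSystem} (hR : R.IsPlane) {κ : E → ℤˣ} (hκ : R.IsKasteleyn κ)
    (β : Fin n ≃ B) (ω : Fin n ≃ W) :
    ∃ ε : ℤˣ, ∀ σ, ∀ μ ∈ G.perfectMatchingsVia β ω σ, Equiv.Perm.sign σ * ∏ e ∈ μ, κ e = ε := by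
  classical
  by_cases h : ∃ σ μ, μ ∈ G.perfectMatchingsVia β ω σ
  · obtain ⟨σ', μ', hμ'⟩ := h
    refine ⟨Equiv.Perm.sign σ' * ∏ e ∈ μ', κ e, fun σ μ hμ => ?_⟩
    obtain ⟨hμ, hσ⟩ := mem_perfectMatchingsVia.1 hμ
    obtain ⟨hμ', hσ'⟩ := mem_perfectMatchingsVia.1 hμ'
    obtain ⟨p, hp, rfl⟩ := hμ.exists_isEdgeChoice hσ
    obtain ⟨p', hp', rfl⟩ := hμ'.exists_isEdgeChoice hσ'
    rw [Finset.prod_image hp.injective.injOn, Finset.prod_image hp'.injective.injOn]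
    exact hp.sign_mul_prod_eq hR hκ hp'
  · exact ⟨1, fun σ μ hμ => absurd ⟨σ, μ, hμ⟩ h⟩

theorem sum_perfectMatchings {A : Type*} [AddCommMonoid A] (β : Fin n ≃ B) (ω : Fin n ≃ W)
    (f : Finset E → A) :
    ∑ μ ∈ G.perfectMatchings, f μ = ∑ σ, ∑ μ ∈ G.perfectMatchingsVia β ω σ, f μ := by
  classical
  simp only [perfectMatchingsVia, Finset.sum_filter]
  rw [Finset.sum_comm]
  refine Finset.sum_congr rfl fun μ hμ => ?_
  obtain ⟨σ, hσ, hunique⟩ := (mem_perfectMatchings.1 hμ).existsUnique_matchesVia β ω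
  rw [Fintype.sum_eq_single σ fun τ hτ => if_neg fun h => hτ (hunique τ h), if_pos hσ]

theorem detTerm_signedMatrix (G : BipartiteGraph B W E) (κ : E → ℤˣ) (β : Fin n ≃ B)
    (ω : Fin n ≃ W) (σ : Equiv.Perm (Fin n)) :
    detTerm (G.signedMatrix κ β ω) σ = ∑ μ ∈ G.perfectMatchingsVia β ω σ,
      MvPolynomial.C ((Equiv.Perm.sign σ * ∏ e ∈ μ, κ e : ℤˣ) : ℤ) * monomial μ := by
  classical
  unfold detTerm signedMatrix
  rw [Finset.prod_univ_sum, Finset.mul_sum]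
  have hchoice {p : Fin n → E} : p ∈ Fintype.piFinset (fun i => Finset.univ.filter fun e =>
      G.black e = β i ∧ G.white e = ω (σ i)) ↔ G.IsEdgeChoice β ω σ p := by
    simp [IsEdgeChoice]
  refine Finset.sum_bij (fun p _ => Finset.univ.image p) (fun p hp => ?_) (fun p hp q hq hpq => ?_)
    (fun μ hμ => ?_) fun p hp => ?_
  · have hp := hchoice.1 hp
    exact mem_perfectMatchingsVia.2 ⟨hp.isPerfectMatching, hp.matchesVia⟩
  · exact (hchoice.1 hp).eq_of_image_eq (hchoice.1 hq) hpq
  · obtain ⟨hμ, hσ⟩ := mem_perfectMatchingsVia.1 hμ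
    obtain ⟨p, hp, rfl⟩ := hμ.exists_isEdgeChoice hσ
    exact ⟨p, hchoice.2 hp, rfl⟩
  · have hinj := (hchoice.1 hp).injective.injOn (s := (Finset.univ : Finset (Fin n)))
    rw [monomial, Finset.prod_image hinj, Finset.prod_image hinj, Finset.prod_mul_distrib]
    push_cast
    simp [mul_assoc]

theorem detTerm_signedMatrix_ne_zero_iff (G : BipartiteGraph B W E) (κ : E → ℤˣ)
    (β : Fin n ≃ B) (ω : Fin n ≃ W) (σ : Equiv.Perm (Fin n)) :
    detTerm (G.signedMatrix κ β ω) σ ≠ 0 ↔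
      ∃ μ, G.IsPerfectMatching μ ∧ G.MatchesVia β ω σ μ := by
  simp only [← mem_perfectMatchingsVia]
  rw [detTerm_signedMatrix]
  refine ⟨Finset.nonempty_of_sum_ne_zero, fun h hzero => ?_⟩
  -- At `X e = κ e`, each of the summands has the value `sign σ`.
  have heval := congrArg (MvPolynomial.eval fun e => ((κ e : ℤˣ) : ℤ)) hzero
  have hsquare (μ : Finset E) : (∏ e ∈ μ, ((κ e : ℤˣ) : ℤ)) * ∏ e ∈ μ, ((κ e : ℤˣ) : ℤ) = 1 := by
    rw [← Units.coe_prod, ← Units.val_mul, Int.units_mul_self, Units.val_one]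
  simp only [monomial, map_sum, map_mul, MvPolynomial.eval_C, map_prod, MvPolynomial.eval_X,
    Units.val_mul, Units.coe_prod, mul_assoc, hsquare, mul_one, Finset.sum_const, nsmul_eq_mul,
    map_zero] at heval
  exact mul_ne_zero (Nat.cast_ne_zero.2 (Finset.card_ne_zero.2 h)) (Units.ne_zero _) heval

end Matchings

end BipartiteGraph

theorem proposition3p4 {B W E : Type*} [Fintype E] {n : ℕ}
    (G : BipartiteGraph B W E) (β : Fin n ≃ B) (ω : Fin n ≃ W)
    (R : G.RotationSystem) (hR : R.IsPlane)
    (κ : E → ℤˣ) (hκ : R.IsKasteleyn κ) :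
    (∀ σ : Equiv.Perm (Fin n),
      detTerm (G.signedMatrix κ β ω) σ ≠ 0 ↔
        ∃ μ : Finset E, G.IsPerfectMatching μ ∧ G.MatchesVia β ω σ μ) ∧
    (∀ μ : Finset E, G.IsPerfectMatching μ →
      ∃! σ : Equiv.Perm (Fin n), G.MatchesVia β ω σ μ) ∧
    ∃ ε : ℤˣ,
      (∀ σ : Equiv.Perm (Fin n),
        detTerm (G.signedMatrix κ β ω) σ =
          MvPolynomial.C ((ε : ℤˣ) : ℤ) *
            ∑ μ ∈ G.perfectMatchingsVia β ω σ, BipartiteGraph.monomial μ) ∧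
      (G.IsSimple → ∀ σ : Equiv.Perm (Fin n), detTerm (G.signedMatrix κ β ω) σ ≠ 0 →
        ∃! μ : Finset E, (G.IsPerfectMatching μ ∧ G.MatchesVia β ω σ μ) ∧
          detTerm (G.signedMatrix κ β ω) σ =
            MvPolynomial.C ((ε : ℤˣ) : ℤ) * BipartiteGraph.monomial μ) ∧
      (G.signedMatrix κ β ω).det =
        MvPolynomial.C ((ε : ℤˣ) : ℤ) *
          ∑ μ ∈ G.perfectMatchings, BipartiteGraph.monomial μ := by
  obtain ⟨ε, hε⟩ := BipartiteGraph.exists_sign hR hκ β ω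
  have hne := G.detTerm_signedMatrix_ne_zero_iff κ β ω
  have hterm (σ : Equiv.Perm (Fin n)) : detTerm (G.signedMatrix κ β ω) σ =
      MvPolynomial.C (ε : ℤ) * ∑ μ ∈ G.perfectMatchingsVia β ω σ, BipartiteGraph.monomial μ := by
    rw [G.detTerm_signedMatrix, Finset.mul_sum]
    exact Finset.sum_congr rfl fun μ hμ => by rw [hε σ μ hμ]
  refine ⟨hne, fun μ hμ => hμ.existsUnique_matchesVia β ω, ε, hterm, fun hG σ hσ => ?_, ?_⟩
  · obtain ⟨μ, hμ, hμσ⟩ := (hne σ).1 hσ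
    have hunique (μ' : Finset E) (h : G.IsPerfectMatching μ' ∧ G.MatchesVia β ω σ μ') : μ' = μ :=
      hG.eq_of_matchesVia h.1 h.2 hμ hμσ
    have hsingleton : G.perfectMatchingsVia β ω σ = {μ} := Finset.eq_singleton_iff_unique_mem.2
      ⟨BipartiteGraph.mem_perfectMatchingsVia.2 ⟨hμ, hμσ⟩,
        fun μ' h => hunique μ' (BipartiteGraph.mem_perfectMatchingsVia.1 h)⟩
    refine ⟨μ, ⟨⟨hμ, hμσ⟩, ?_⟩, fun μ' h => hunique μ' h.1⟩
    rw [hterm, hsingleton, Finset.sum_singleton]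
  · rw [det_eq_sum_detTerm, G.sum_perfectMatchings β ω, Finset.mul_sum]
    exact Finset.sum_congr rfl fun σ _ => hterm σ
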